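/- Let $2\le m<n$ be integers. For a non-empty digit set $\mathcal D\subset\{0,\dots,n-1\}\times\{0,\dots,m-1\}$ and $d\in\mathcal D$ put $S_d(z)=\operatorname{diag}(n^{-1},m^{-1})(z+d)$ for $z\in\mathbb R^2$. Let $E=K(n,m,\mathcal D)$ be the unique non-empty compact set with $E=\bigcup_{d\in\mathcal D}S_d(E)$ (a self-affine carpet), and let $\mu_E$, the uniform Bernoulli measure of $E$, be the unique Borel probability measure on $E$ with $\mu_E=\frac1{\#\mathcal D}\sum_{d\in\mathcal D}\mu_E\circ S_d^{-1}$. Let $F=K(n,m,\mathcal D')$ and $\mu_F$ be obtained in the same way from a non-empty digit set $\mathcal D'\subset\{0,\dots,n-1\}\times\{0,\dots,m-1\}$. For a Borel probability measure $\mu$ on a metric space $X$ and $\alpha\in\mathbb R$ let $X_\alpha$ be the set of all $x\in X$ for which $\lim_{r\to0^+}\frac{\log\mu(B(x,r))}{\log r}$ exists and equals $\alpha$, where $B(x,r)$ is the closed ball in $X$; the function $h_\mu(\alpha)=\dim_H X_\alpha$ (with $\dim_H\emptyset=0$) is the multifractal spectrum of $\mu$. The measure $\mu$ is doubling if there is a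 constant $C\ge1$ such that $0<\mu(B(x,2r))\le C\mu(B(x,r))<\infty$ for all $x\in X$ and $r>0$. Suppose that $E$ and $F$, with the Euclidean metric, are totally disconnected and bi-Lipschitz equivalent, that is, there are a map $f$ of $E$ onto $F$ and a constant $C>0$ with $C^{-1}|x-y|\le|f(x)-f(y)|\le C|x-y|$ for all $x,y\in E$. Then (i) $\mu_E$ and $\mu_F$ have the same multifractal spectrum: $h_{\mu_E}(\alpha)=h_{\mu_F}(\alpha)$ for every $\alpha\in\mathbb R$; (ii) $\mu_E$ is doubling if and only if $\mu_F$ is doubling. -/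

import Mathlib

open MeasureTheory Filter Topology
open scoped ENNReal NNReal

noncomputable section

/-! ### Metric notions -/

/-- Lipschitz equivalence of metric spaces: there is a map of `X` onto `Y` that distorts distances
by at most a constant factor (such a map is automatically injective). -/
def LipschitzEquivalent (X Y : Type*) [MetricSpace X] [MetricSpace Y] : Prop :=
  ∃ f : X → Y, Function.Surjective f ∧ ∃ C : ℝ, 0 < C ∧
    ∀ x y, C⁻¹ * dist x y ≤ dist (f x) (f y) ∧ dist (f x) (f y) ≤ C * dist x y

section Multifractal

variable {X : Type*} [MetricSpace X] [MeasurableSpace X] [BorelSpace X]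

/-- `log μ(B(x,r)) / log r`, with the convention `log 0 = -∞`. -/
def logRatio (μ : Measure X) (x : X) (r : ℝ) : EReal :=
  ENNReal.log (μ (Metric.closedBall x r)) / ((Real.log r : ℝ) : EReal)

/-- Upper local dimension of `μ` at `x`. -/
def upperLocalDim (μ : Measure X) (x : X) : EReal :=
  limsup (fun r : ℝ => logRatio μ x r) (𝓝[>] 0)

/-- Lower local dimension of `μ` at `x`. -/
def lowerLocalDim (μ : Measure X) (x : X) : EReal :=
  liminf (fun r : ℝ => logRatio μ x r) (𝓝[>] 0)

/-- The set of points at which the local dimension of `μ` exists and equals `α`. -/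
def levelSet (μ : Measure X) (α : ℝ) : Set X :=
  {x | upperLocalDim μ x = (α : EReal) ∧ lowerLocalDim μ x = (α : EReal)}

/-- The multifractal spectrum of `μ`: the Hausdorff dimensions of its level sets. -/
def multifractalSpectrum (μ : Measure X) (α : ℝ) : ℝ≥0∞ :=
  dimH (levelSet μ α)

/-- A doubling measure. -/
def IsDoublingMeasure (μ : Measure X) : Prop :=
  ∃ C : ℝ≥0, 1 ≤ C ∧ ∀ (x : X) (r : ℝ), 0 < r →
    0 < μ (Metric.closedBall x (2 * r)) ∧
    μ (Metric.closedBall x (2 * r)) ≤ C * μ (Metric.closedBall x r) ∧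
    (C : ℝ≥0∞) * μ (Metric.closedBall x r) < ∞

end Multifractal

/-! ### Self-affine carpets -/

/-- The Euclidean plane. -/
abbrev Plane : Type := EuclideanSpace ℝ (Fin 2)

/-- A (non-empty) digit set in `{0, …, n-1} × {0, …, m-1}`. -/
structure DigitSet (n m : ℕ) where
  /-- the digits -/
  digits : Finset (Fin n × Fin m)
  nonempty : digits.Nonempty

namespace DigitSet

variable {n m : ℕ} (D : DigitSet n m)

/-- The type of digits of `D`. -/
abbrev Digit : Type := {d : Fin n × Fin m // d ∈ D.digits}

instance : Nonempty D.Digit := D.nonempty.to_subtype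

/-- The contraction `S_d(z) = diag(1/n, 1/m) (z + d)`. -/
def S (d : D.Digit) (z : Plane) : Plane :=
  !₂[(z 0 + (d.1.1 : ℕ)) / n, (z 1 + (d.1.2 : ℕ)) / m]

/-- The point `(∑ x_k n^{-k}, ∑ y_k m^{-k})` with the digits `(x_k, y_k)`, `k = 1, 2, …`
(which are listed as `ω 0, ω 1, …`). It is the limit of `S_{ω 0} ∘ ⋯ ∘ S_{ω k}`. -/
def code (ω : ℕ → D.Digit) : Plane :=
  !₂[∑' k, (((ω k).1.1 : ℕ) : ℝ) / (n : ℝ) ^ (k + 1),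
    ∑' k, (((ω k).1.2 : ℕ) : ℝ) / (m : ℝ) ^ (k + 1)]

/-- The Bedford-McMullen carpet `K(n, m, D)`. By `carpet_spec` and `carpet_unique` below it is the
unique non-empty compact set `K` with `K = ⋃ d, S_d(K)`. -/
def carpet : Set Plane := Set.range D.code

/-- The coding map as a map onto the carpet. -/
def toCarpet (ω : ℕ → D.Digit) : D.carpet := ⟨D.code ω, ω, rfl⟩

/-- The uniform Bernoulli measure of the carpet: the law of the random point whose digits are
independent and uniformly distributed in `D`. By `uniformMeasure_spec` and `uniformMeasure_unique`
below, it is the unique Borel probability measure `μ` on the carpet with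
`μ = ∑ d, (1/N) μ ∘ S_d⁻¹`, where `N` is the number of digits. -/
def uniformMeasure : Measure D.carpet :=
  (Measure.infinitePi fun _ : ℕ => ProbabilityTheory.uniformOn (Set.univ : Set D.Digit)).map
    D.toCarpet

/-! ### The definitions agree with the usual characterizations -/

theorem digit_bound {b : ℕ} (hb : 2 ≤ b) (a : Fin b) (k : ℕ) :
    ‖((a : ℕ) : ℝ) / (b : ℝ) ^ (k + 1)‖ ≤ (1 / 2 : ℝ) ^ k := by
  have hb' : (2 : ℝ) ≤ b := by exact_mod_cast hb
  have hb0 : (0 : ℝ) < b := by linarith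
  have ha : ((a : ℕ) : ℝ) ≤ b := by exact_mod_cast a.2.le
  rw [Real.norm_of_nonneg (by positivity), pow_succ, one_div, inv_pow]
  calc ((a : ℕ) : ℝ) / ((b : ℝ) ^ k * b) ≤ b / ((b : ℝ) ^ k * b) := by gcongr
    _ = ((b : ℝ) ^ k)⁻¹ := by field_simp
    _ ≤ ((2 : ℝ) ^ k)⁻¹ := by gcongr

theorem digit_summable {b : ℕ} (hb : 2 ≤ b) (a : ℕ → Fin b) :
    Summable fun k => ((a k : ℕ) : ℝ) / (b : ℝ) ^ (k + 1) :=
  Summable.of_norm_bounded summable_geometric_two fun k => digit_bound hb (a k) k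

theorem digit_tsum {b : ℕ} (hb : 2 ≤ b) (a : ℕ → Fin b) :
    ∑' k, ((a k : ℕ) : ℝ) / (b : ℝ) ^ (k + 1) =
      (∑' k, ((a (k + 1) : ℕ) : ℝ) / (b : ℝ) ^ (k + 1) + (a 0 : ℕ)) / b := by
  have hb0 : (b : ℝ) ≠ 0 := by positivity
  rw [(digit_summable hb a).tsum_eq_zero_add, add_div, ← tsum_div_const, add_comm]
  congr 1
  · refine tsum_congr fun k => ?_
    rw [div_div, ← pow_succ]
  · simp

theorem code_eq (hn : 2 ≤ n) (hm : 2 ≤ m) (ω : ℕ → D.Digit) :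
    D.code ω = D.S (ω 0) (D.code fun k => ω (k + 1)) := by
  ext i
  fin_cases i
  · simpa [code, S] using digit_tsum hn fun k => (ω k).1.1
  · simpa [code, S] using digit_tsum hm fun k => (ω k).1.2

theorem continuous_code (hn : 2 ≤ n) (hm : 2 ≤ m) : Continuous D.code := by
  have h : ∀ {b : ℕ} (_ : 2 ≤ b) (p : D.Digit → Fin b), Continuous fun ω : ℕ → D.Digit =>
      ∑' k, ((p (ω k) : ℕ) : ℝ) / (b : ℝ) ^ (k + 1) := by
    intro b hb p
    refine continuous_tsum (fun k => ?_) summable_geometric_two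
      fun k ω => digit_bound hb (p (ω k)) k
    exact (continuous_of_discreteTopology (f := fun d : D.Digit =>
      ((p d : ℕ) : ℝ) / (b : ℝ) ^ (k + 1))).comp (continuous_apply k)
  refine (PiLp.continuous_toLp 2 _).comp (continuous_pi fun i => ?_)
  fin_cases i
  · exact h hn fun d => d.1.1
  · exact h hm fun d => d.1.2

theorem continuous_S (d : D.Digit) : Continuous (D.S d) := by
  refine (PiLp.continuous_toLp 2 _).comp (continuous_pi fun i => ?_)
  fin_cases i
  · simp only [Fin.zero_eta, Matrix.cons_val_zero]; fun_prop
  · simp only [Fin.mk_one, Matrix.cons_val_one]; fun_prop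

theorem dist_S_le (hn : 2 ≤ n) (hm : 2 ≤ m) (d : D.Digit) (z w : Plane) :
    dist (D.S d z) (D.S d w) ≤ dist z w / 2 := by
  have hn' : (2 : ℝ) ≤ n := by exact_mod_cast hn
  have hm' : (2 : ℝ) ≤ m := by exact_mod_cast hm
  have key : ∀ {b : ℝ}, 2 ≤ b → ∀ u v c : ℝ,
      dist ((u + c) / b) ((v + c) / b) ^ 2 ≤ dist u v ^ 2 / 4 := by
    intro b hb u v c
    have : (u + c) / b - (v + c) / b = (u - v) / b := by ring
    rw [Real.dist_eq, Real.dist_eq, this, sq_abs, sq_abs, div_pow]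
    gcongr
    nlinarith
  rw [EuclideanSpace.dist_eq, EuclideanSpace.dist_eq, Real.sqrt_le_left (by positivity), div_pow,
    Real.sq_sqrt (by positivity)]
  simp only [Fin.sum_univ_two, S]
  have h0 := key hn' (z 0) (w 0) (d.1.1 : ℕ)
  have h1 := key hm' (z 1) (w 1) (d.1.2 : ℕ)
  simp only [Matrix.cons_val_zero, Matrix.cons_val_one]
  linarith

/-- Prepending a digit to a digit sequence. -/
def consDigit (d : D.Digit) (ω : ℕ → D.Digit) : ℕ → D.Digit := fun k => Nat.casesOn k d ω

theorem code_consDigit (hn : 2 ≤ n) (hm : 2 ≤ m) (d : D.Digit) (ω : ℕ → D.Digit) :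
    D.code (D.consDigit d ω) = D.S d (D.code ω) :=
  D.code_eq hn hm (D.consDigit d ω)

theorem S_mem_carpet (hn : 2 ≤ n) (hm : 2 ≤ m) (d : D.Digit) {z : Plane} (hz : z ∈ D.carpet) :
    D.S d z ∈ D.carpet := by
  obtain ⟨ω, rfl⟩ := hz
  exact ⟨D.consDigit d ω, D.code_consDigit hn hm d ω⟩

/-- The carpet is non-empty, compact and invariant. -/
theorem carpet_spec (hn : 2 ≤ n) (hm : 2 ≤ m) :
    D.carpet.Nonempty ∧ IsCompact D.carpet ∧ D.carpet = ⋃ d, D.S d '' D.carpet := by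
  refine ⟨Set.range_nonempty _, isCompact_range (D.continuous_code hn hm), ?_⟩
  apply Set.Subset.antisymm
  · rintro _ ⟨ω, rfl⟩
    exact Set.mem_iUnion.2 ⟨ω 0, _, ⟨fun k => ω (k + 1), rfl⟩, (D.code_eq hn hm ω).symm⟩
  · refine Set.iUnion_subset fun d => ?_
    rintro _ ⟨z, hz, rfl⟩
    exact D.S_mem_carpet hn hm d hz

/-- The carpet is the only non-empty compact invariant set. -/
theorem carpet_unique (hn : 2 ≤ n) (hm : 2 ≤ m) {K : Set Plane} (hne : K.Nonempty)
    (hK : IsCompact K) (hinv : K = ⋃ d, D.S d '' K) : K = D.carpet := by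
  obtain ⟨-, hC, hCinv⟩ := D.carpet_spec hn hm
  have hbdd : Bornology.IsBounded (K ∪ D.carpet) := hK.isBounded.union hC.isBounded
  -- every point of one invariant set is within `R / 2 ^ k` of the other one
  have main : ∀ A B : Set Plane, A ⊆ K ∪ D.carpet → B ⊆ K ∪ D.carpet → B.Nonempty → IsClosed B →
      A = ⋃ d, D.S d '' A → B = ⋃ d, D.S d '' B → A ⊆ B := by
    intro A B hA hB hBne hBc hAi hBi a ha
    have step : ∀ k : ℕ, ∀ a ∈ A, ∃ b ∈ B,
        dist b a ≤ (1 / 2 : ℝ) ^ k * Metric.diam (K ∪ D.carpet) := by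
      intro k
      induction k with
      | zero =>
        intro a ha
        obtain ⟨b, hb⟩ := hBne
        exact ⟨b, hb, by simpa using Metric.dist_le_diam_of_mem hbdd (hB hb) (hA ha)⟩
      | succ k ih =>
        intro a ha
        rw [hAi] at ha
        obtain ⟨d, a', ha', rfl⟩ := Set.mem_iUnion.1 ha
        obtain ⟨b, hb, hab⟩ := ih a' ha'
        refine ⟨D.S d b, ?_, ?_⟩
        · rw [hBi]
          exact Set.mem_iUnion.2 ⟨d, b, hb, rfl⟩
        · have := D.dist_S_le hn hm d b a'
          rw [pow_succ]
          linarith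
    choose b hb hba using fun k => step k a ha
    refine hBc.mem_of_tendsto (f := b) (b := atTop) ?_ (Eventually.of_forall hb)
    rw [tendsto_iff_dist_tendsto_zero]
    refine squeeze_zero (fun _ => dist_nonneg) hba ?_
    simpa using (tendsto_pow_atTop_nhds_zero_of_lt_one (r := (1 / 2 : ℝ)) (by norm_num)
      (by norm_num)).mul_const (Metric.diam (K ∪ D.carpet))
  exact Set.Subset.antisymm
    (main K D.carpet Set.subset_union_left Set.subset_union_right (Set.range_nonempty _)
      hC.isClosed hinv hCinv)
    (main D.carpet K Set.subset_union_right Set.subset_union_left hne hK.isClosed hCinv hinv)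

/-- The contraction `S_d` as a map of the carpet into itself. -/
def carpetMap (hn : 2 ≤ n) (hm : 2 ≤ m) (d : D.Digit) (z : D.carpet) : D.carpet :=
  ⟨D.S d z, D.S_mem_carpet hn hm d z.2⟩

theorem continuous_carpetMap (hn : 2 ≤ n) (hm : 2 ≤ m) (d : D.Digit) :
    Continuous (D.carpetMap hn hm d) :=
  ((D.continuous_S d).comp continuous_subtype_val).subtype_mk _

theorem measurable_code (hn : 2 ≤ n) (hm : 2 ≤ m) :
    Measurable D.toCarpet :=
  Measurable.subtype_mk (D.continuous_code hn hm).measurable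

theorem measurable_consDigit (d : D.Digit) : Measurable (D.consDigit d) := by
  refine measurable_pi_lambda _ fun k => ?_
  cases k with
  | zero => exact measurable_const
  | succ k => exact measurable_pi_apply k

theorem infinitePi_cons :
    (∑ d : D.Digit, (Fintype.card D.Digit : ℝ≥0∞)⁻¹ • (Measure.infinitePi fun _ : ℕ =>
        ProbabilityTheory.uniformOn (Set.univ : Set D.Digit)).map (D.consDigit d)) =
      Measure.infinitePi fun _ : ℕ => ProbabilityTheory.uniformOn (Set.univ : Set D.Digit) := by
  classical
  set u := ProbabilityTheory.uniformOn (Set.univ : Set D.Digit) with hu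
  refine Measure.eq_infinitePi _ fun s t ht => ?_
  obtain ⟨k, hk⟩ : ∃ k, s ⊆ Finset.range (k + 1) :=
    ⟨s.sup id, fun i hi => Finset.mem_range.2 (Nat.lt_succ_of_le (Finset.le_sup (f := id) hi))⟩
  set t' : ℕ → Set D.Digit := fun i => if i ∈ s then t i else Set.univ with ht'
  have hmeas : ∀ A : Set D.Digit, MeasurableSet A := fun A => A.toFinite.measurableSet
  have e1 : Set.pi (s : Set ℕ) t = Set.pi (Finset.range (k + 1) : Set ℕ) t' := by
    ext ω
    simp only [Set.mem_pi, Finset.mem_coe, ht']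
    constructor
    · intro h i _
      split_ifs with hi
      · exact h i hi
      · trivial
    · intro h i hi
      simpa [hi] using h i (hk hi)
  have e2 : ∏ i ∈ s, u (t i) = ∏ i ∈ Finset.range (k + 1), u (t' i) := by
    rw [← Finset.prod_subset hk (f := fun i => u (t' i))]
    · exact Finset.prod_congr rfl fun i hi => by simp [ht', hi]
    · intro i _ hi
      simp [ht', hi]
  have e3 : ∀ d : D.Digit, (Measure.infinitePi fun _ : ℕ => u)
      (D.consDigit d ⁻¹' Set.pi (Finset.range (k + 1) : Set ℕ) t') =
      (t' 0).indicator (fun _ => ∏ i ∈ Finset.range k, u (t' (i + 1))) d := by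
    intro d
    by_cases hd : d ∈ t' 0
    · have : D.consDigit d ⁻¹' Set.pi (Finset.range (k + 1) : Set ℕ) t' =
          Set.pi (Finset.range k : Set ℕ) fun i => t' (i + 1) := by
        ext ω
        simp only [Set.mem_preimage, Set.mem_pi, Finset.mem_coe, Finset.mem_range]
        constructor
        · intro h i hi
          exact h (i + 1) (by omega)
        · intro h i hi
          cases i with
          | zero => exact hd
          | succ i => exact h i (by omega)
      rw [this, Measure.infinitePi_pi _ fun i _ => hmeas _, Set.indicator_of_mem hd]
    · have : D.consDigit d ⁻¹' Set.pi (Finset.range (k + 1) : Set ℕ) t' = ∅ := by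
        ext ω
        simp only [Set.mem_preimage, Set.mem_pi, Finset.mem_coe, Finset.mem_range,
          Set.mem_empty_iff_false, iff_false]
        intro h
        exact hd (h 0 (by omega))
      rw [this, measure_empty, Set.indicator_of_notMem hd]
  rw [e1, e2, Finset.prod_range_succ']
  have hset : MeasurableSet (Set.pi (Finset.range (k + 1) : Set ℕ) t') :=
    MeasurableSet.pi (Finset.countable_toSet _) fun i _ => hmeas _
  simp only [Measure.coe_finsetSum, Finset.sum_apply, Measure.smul_apply, smul_eq_mul,
    Measure.map_apply (D.measurable_consDigit _) hset, e3]
  rw [← Finset.mul_sum, hu, ProbabilityTheory.uniformOn_univ, Measure.count_apply (hmeas _)]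
  rw [Finset.sum_indicator_eq_sum_filter, Finset.sum_const, nsmul_eq_mul]
  have : (t' 0).encard = ((Finset.univ.filter fun d => d ∈ t' 0).card : ℕ∞) := by
    rw [← Set.encard_coe_eq_coe_finsetCard]
    simp
  rw [this]
  simp only [ENat.toENNReal_coe]
  rw [ENNReal.div_eq_inv_mul]
  ring

instance : Nonempty D.carpet := (Set.range_nonempty D.code).to_subtype

/-- The uniform Bernoulli measure is a probability measure and satisfies the self-affine
equation. -/
theorem uniformMeasure_spec (hn : 2 ≤ n) (hm : 2 ≤ m) :
    IsProbabilityMeasure D.uniformMeasure ∧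
      D.uniformMeasure = ∑ d : D.Digit, (Fintype.card D.Digit : ℝ≥0∞)⁻¹ •
        D.uniformMeasure.map (D.carpetMap hn hm d) := by
  have hc := D.measurable_code hn hm
  refine ⟨Measure.isProbabilityMeasure_map hc.aemeasurable, ?_⟩
  have hcomm : ∀ d, D.carpetMap hn hm d ∘ D.toCarpet =
      D.toCarpet ∘ D.consDigit d := by
    intro d
    funext ω
    apply Subtype.ext
    exact (D.code_consDigit hn hm d ω).symm
  have h : ∀ d, D.uniformMeasure.map (D.carpetMap hn hm d) =
      ((Measure.infinitePi fun _ : ℕ => ProbabilityTheory.uniformOn (Set.univ : Set D.Digit)).map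
        (D.consDigit d)).map D.toCarpet := by
    intro d
    rw [uniformMeasure, Measure.map_map (D.continuous_carpetMap hn hm d).measurable hc,
      Measure.map_map hc (D.measurable_consDigit d), hcomm]
  simp only [h]
  conv_lhs => rw [uniformMeasure, ← D.infinitePi_cons]
  ext A hA
  rw [Measure.map_apply hc hA]
  simp only [Measure.coe_finsetSum, Finset.sum_apply, Measure.smul_apply, smul_eq_mul,
    Measure.map_apply hc hA]

/-- The uniform Bernoulli measure is the only probability measure on the carpet that satisfies the
self-affine equation. -/
theorem uniformMeasure_unique (hn : 2 ≤ n) (hm : 2 ≤ m) (ν : Measure D.carpet)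
    [IsProbabilityMeasure ν]
    (hν : ν = ∑ d : D.Digit, (Fintype.card D.Digit : ℝ≥0∞)⁻¹ • ν.map (D.carpetMap hn hm d)) :
    ν = D.uniformMeasure := by
  obtain ⟨hμp, hμ⟩ := D.uniformMeasure_spec hn hm
  have hcomp : CompactSpace D.carpet := isCompact_iff_compactSpace.1 (D.carpet_spec hn hm).2.1
  set N : ℝ := (Fintype.card D.Digit : ℝ) with hN
  have hN0 : 0 < N := by simpa [hN] using Fintype.card_pos (α := D.Digit)
  set R : ℝ := Metric.diam (Set.univ : Set D.carpet) with hR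
  have hint : ∀ (ρ : Measure D.carpet) [IsProbabilityMeasure ρ] (g : D.carpet → ℝ),
      Continuous g → Integrable g ρ := fun ρ _ g hg =>
    hg.integrable_of_hasCompactSupport (HasCompactSupport.of_compactSpace g)
  -- integrals are invariant under averaging over the contractions
  have havg : ∀ (ρ : Measure D.carpet) [IsProbabilityMeasure ρ],
      ρ = ∑ d : D.Digit, (Fintype.card D.Digit : ℝ≥0∞)⁻¹ • ρ.map (D.carpetMap hn hm d) →
      ∀ g : D.carpet → ℝ, Continuous g →
        ∫ x, g x ∂ρ = ∫ x, N⁻¹ * ∑ d, g (D.carpetMap hn hm d x) ∂ρ := by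
    intro ρ _ hρ g hg
    have hcm := fun d => (D.continuous_carpetMap hn hm d)
    conv_lhs => rw [hρ]
    rw [integral_finsetSum_measure, integral_const_mul, integral_finsetSum, Finset.mul_sum]
    · refine Finset.sum_congr rfl fun d _ => ?_
      rw [integral_smul_measure, integral_map (hcm d).measurable.aemeasurable
        hg.aestronglyMeasurable]
      simp [hN]
    · exact fun d _ => hint ρ _ (hg.comp (hcm d))
    · intro d _
      have : IsProbabilityMeasure (ρ.map (D.carpetMap hn hm d)) :=
        Measure.isProbabilityMeasure_map (hcm d).measurable.aemeasurable
      exact (hint _ g hg).smul_measure (by simp [D.nonempty.ne_empty])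
  have main : ∀ (k : ℕ) (g : D.carpet → ℝ), Continuous g → ∀ ε : ℝ,
      (∀ x y, dist x y ≤ (1 / 2 : ℝ) ^ k * R → |g x - g y| ≤ ε) →
      |∫ x, g x ∂ν - ∫ x, g x ∂D.uniformMeasure| ≤ ε := by
    intro k
    induction k with
    | zero =>
      intro g hg ε h
      have h' : ∀ x y, |g x - g y| ≤ ε := fun x y => h x y (by
        simpa [hR] using Metric.dist_le_diam_of_mem (isCompact_univ.isBounded)
          (Set.mem_univ x) (Set.mem_univ y))
      have hy : ∀ y, |∫ x, g x ∂ν - g y| ≤ ε := by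
        intro y
        have : ∫ x, g x ∂ν - g y = ∫ x, (g x - g y) ∂ν := by
          rw [integral_sub (hint ν g hg) (integrable_const _)]; simp
        rw [this, ← Real.norm_eq_abs]
        simpa using norm_integral_le_of_norm_le_const (μ := ν) (f := fun x => g x - g y) (C := ε)
          (Eventually.of_forall fun x => h' x y)
      have : ∫ x, g x ∂ν - ∫ x, g x ∂D.uniformMeasure =
          ∫ y, (∫ x, g x ∂ν - g y) ∂D.uniformMeasure := by
        rw [integral_sub (integrable_const _) (hint _ g hg)]; simp
      rw [this, ← Real.norm_eq_abs]
      simpa using norm_integral_le_of_norm_le_const (μ := D.uniformMeasure)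
        (f := fun y => ∫ x, g x ∂ν - g y) (C := ε) (Eventually.of_forall hy)
    | succ k ih =>
      intro g hg ε h
      rw [havg ν hν g hg, havg D.uniformMeasure hμ g hg]
      refine ih _ ?_ ε fun x y hxy => ?_
      · exact continuous_const.mul (continuous_finsetSum _ fun d _ =>
          hg.comp (D.continuous_carpetMap hn hm d))
      · rw [← mul_sub, ← Finset.sum_sub_distrib, abs_mul, abs_of_pos (inv_pos.2 hN0)]
        have hd : ∀ d, |g (D.carpetMap hn hm d x) - g (D.carpetMap hn hm d y)| ≤ ε := by
          intro d
          refine h _ _ ?_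
          have h1 : dist (D.carpetMap hn hm d x) (D.carpetMap hn hm d y) ≤ dist x y / 2 :=
            D.dist_S_le hn hm d x y
          rw [pow_succ]
          linarith
        calc N⁻¹ * |∑ d, (g (D.carpetMap hn hm d x) - g (D.carpetMap hn hm d y))|
            ≤ N⁻¹ * ∑ _d : D.Digit, ε := by
              gcongr
              exact (Finset.abs_sum_le_sum_abs _ _).trans (Finset.sum_le_sum fun d _ => hd d)
          _ = ε := by
              simp only [Finset.sum_const, Finset.card_univ, nsmul_eq_mul, ← hN]
              field_simp
  refine ext_of_forall_integral_eq_of_IsFiniteMeasure fun g => ?_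
  by_contra hne
  set δ := |∫ x, g x ∂ν - ∫ x, g x ∂D.uniformMeasure| with hδ
  have hδ0 : 0 < δ := abs_pos.2 (sub_ne_zero.2 hne)
  have huc : UniformContinuous g := CompactSpace.uniformContinuous_of_continuous g.continuous
  obtain ⟨η, hη, hgη⟩ := Metric.uniformContinuous_iff.1 huc (δ / 2) (by linarith)
  have hlim : Tendsto (fun k : ℕ => (1 / 2 : ℝ) ^ k * R) atTop (𝓝 0) := by
    simpa using (tendsto_pow_atTop_nhds_zero_of_lt_one (r := (1 / 2 : ℝ)) (by norm_num)
      (by norm_num)).mul_const R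
  obtain ⟨k, hk⟩ := (hlim.eventually_lt_const hη).exists
  have := main k g g.continuous (δ / 2) fun x y hxy => by
    rw [← Real.dist_eq]
    exact (hgη (hxy.trans_lt hk)).le
  linarith

end DigitSet

end

/-! The heart of the matter is that a bi-Lipschitz map carries one uniform measure to a measure
comparable with the other: the mass of a ball of radius `r` about `f x` is at most a constant times
the mass of the ball of radius `(2C+1)r` about `x`, and symmetrically for the inverse
(`uniformMeasure_closedBall_le`). Given this, constant factors in mass and radius do not affect
local dimensions, so `f` and its inverse exchange the level sets, whose Hausdorff dimensions then
agree; and doubling passes across because finitely many doublings absorb the change of radius.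

The uniform measure is read off from box counts. Every cylinder of rank `k` meets the same number
`V` of boxes of a fixed finer rank, and distinct cylinders meet distinct boxes
(`ncard_image_boxIndex`). Hence the measure of a union of cylinders is the proportion of boxes that
it meets. If the boxes are approximate squares, with sides `n⁻ˡ` and `m⁻ᴷ` comparable, a Lipschitz
map increases their number by at most a bounded factor (`ncard_image_boxIndex_le`). Applying this to
a union of cylinders through `f`, and to the whole carpet through the inverse, compares the two
proportions with a constant independent of `k` (`ncard_cylinders_le`). Balls are then approximated
by unions of small cylinders.

Boxes are indexed by digit sequences rather than points. A point with several codes is harmless,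
since its indices differ by a bounded amount. -/

/-! ### Prefixes of base `b` expansions -/

/-- The integer whose base `b` digits are the first `k` terms of `a`. -/
def prefixValue (b : ℕ) (a : ℕ → ℕ) : ℕ → ℕ
  | 0 => 0
  | k + 1 => b * prefixValue b a k + a k

theorem prefixValue_lt {b : ℕ} {a : ℕ → ℕ} (ha : ∀ i, a i < b) (k : ℕ) :
    prefixValue b a k < b ^ k := by
  induction k with
  | zero => simp [prefixValue]
  | succ k ih =>
    have h1 := ha k
    have h2 : b * (prefixValue b a k + 1) ≤ b * b ^ k := Nat.mul_le_mul_left b ih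
    rw [prefixValue, pow_succ]
    linarith

theorem prefixValue_congr {b : ℕ} {a a' : ℕ → ℕ} {k : ℕ} (h : ∀ i < k, a i = a' i) :
    prefixValue b a k = prefixValue b a' k := by
  induction k with
  | zero => rfl
  | succ k ih =>
    rw [prefixValue, prefixValue, ih fun i hi => h i (by omega), h k (by omega)]

theorem prefixValue_add (b : ℕ) (a : ℕ → ℕ) (k j : ℕ) :
    prefixValue b a (k + j) = prefixValue b a k * b ^ j + prefixValue b (fun i => a (k + i)) j := by
  induction j with
  | zero => simp [prefixValue]
  | succ j ih =>
    rw [← add_assoc, prefixValue, ih, prefixValue, pow_succ]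
    ring

theorem eq_of_mul_add_eq {b u v p q : ℕ} (hp : p < b) (hq : q < b)
    (h : u * b + p = v * b + q) : u = v ∧ p = q := by
  have hb : 0 < b := by omega
  have h1 := congrArg (· / b) h
  have h2 := congrArg (· % b) h
  simp only [Nat.mul_add_mod', Nat.mod_eq_of_lt hp, Nat.mod_eq_of_lt hq] at h2
  subst h2
  exact ⟨Nat.eq_of_mul_eq_mul_right hb (by omega), rfl⟩

theorem eq_of_prefixValue_eq {b : ℕ} {a a' : ℕ → ℕ} (ha : ∀ i, a i < b) (ha' : ∀ i, a' i < b)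
    {k : ℕ} (h : prefixValue b a k = prefixValue b a' k) : ∀ i < k, a i = a' i := by
  induction k with
  | zero => simp
  | succ k ih =>
    rw [prefixValue, prefixValue, mul_comm, mul_comm b] at h
    obtain ⟨h1, h2⟩ := eq_of_mul_add_eq (ha k) (ha' k) h
    intro i hi
    rcases Nat.lt_succ_iff_lt_or_eq.1 hi with hi | rfl
    · exact ih h1 i hi
    · exact h2

theorem prefixValue_div_pow {b : ℕ} (hb : b ≠ 0) (a : ℕ → ℕ) (k : ℕ) :
    (prefixValue b a k : ℝ) / (b : ℝ) ^ k =
      ∑ i ∈ Finset.range k, (a i : ℝ) / (b : ℝ) ^ (i + 1) := by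
  have hb' : (b : ℝ) ≠ 0 := by exact_mod_cast hb
  induction k with
  | zero => simp [prefixValue]
  | succ k ih =>
    rw [Finset.sum_range_succ, ← ih, prefixValue]
    push_cast
    field_simp
    ring

/-- A number is determined by its first `k` digits up to `2 b⁻ᵏ`. -/
theorem abs_pow_mul_tsum_sub_prefixValue_le {b : ℕ} (hb : 2 ≤ b) (a : ℕ → Fin b) (k : ℕ) :
    0 ≤ (b : ℝ) ^ k * (∑' i, ((a i : ℕ) : ℝ) / (b : ℝ) ^ (i + 1)) -
        prefixValue b (fun i => a i) k ∧
      (b : ℝ) ^ k * (∑' i, ((a i : ℕ) : ℝ) / (b : ℝ) ^ (i + 1)) -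
        prefixValue b (fun i => a i) k ≤ 2 := by
  have hb0 : (b : ℝ) ≠ 0 := by positivity
  have htail : ∑' i, ((a (i + k) : ℕ) : ℝ) / (b : ℝ) ^ (i + k + 1) =
      (∑' i, ((a (i + k) : ℕ) : ℝ) / (b : ℝ) ^ (i + 1)) / (b : ℝ) ^ k := by
    rw [← tsum_div_const]
    refine tsum_congr fun i => ?_
    rw [div_div, ← pow_add]
    congr 2
    omega
  have key : (b : ℝ) ^ k * (∑' i, ((a i : ℕ) : ℝ) / (b : ℝ) ^ (i + 1)) -
      prefixValue b (fun i => a i) k = ∑' i, ((a (i + k) : ℕ) : ℝ) / (b : ℝ) ^ (i + 1) := by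
    rw [← (DigitSet.digit_summable hb a).sum_add_tsum_nat_add k, htail,
      ← prefixValue_div_pow (by omega) fun i => (a i : ℕ)]
    field_simp
    ring
  rw [key]
  refine ⟨tsum_nonneg fun i => by positivity, ?_⟩
  -- The tail is dominated by `∑ 2⁻ⁱ = 2`, uniformly in `b ≥ 2`.
  exact (le_abs_self _).trans (tsum_of_norm_bounded hasSum_geometric_two
    fun i => DigitSet.digit_bound hb (a (i + k)) i)

/-! ### Boxes and cylinders in the space of digit sequences -/

noncomputable section

namespace DigitSet

variable {n m : ℕ} (D : DigitSet n m)

/-- The first coordinates of the digits of `ω`. -/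
def colDigit (ω : ℕ → D.Digit) (i : ℕ) : ℕ := (ω i).1.1

/-- The second coordinates of the digits of `ω`. -/
def rowDigit (ω : ℕ → D.Digit) (i : ℕ) : ℕ := (ω i).1.2

theorem colDigit_lt (ω : ℕ → D.Digit) (i : ℕ) : D.colDigit ω i < n := (ω i).1.1.2

theorem rowDigit_lt (ω : ℕ → D.Digit) (i : ℕ) : D.rowDigit ω i < m := (ω i).1.2.2

/-- The lower left corner `(I / nˡ, J / mᴷ)` of the box of rank `(l, K)` of `ω`, given as
`(I, J)`. -/
def boxIndex (l K : ℕ) (ω : ℕ → D.Digit) : ℕ × ℕ :=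
  (prefixValue n (D.colDigit ω) l, prefixValue m (D.rowDigit ω) K)

/-- The first `k` digits of a sequence. -/
def take (k : ℕ) (ω : ℕ → D.Digit) (i : Fin k) : D.Digit := ω i

/-- Concatenation of a finite word and a sequence. -/
def append {k : ℕ} (w : Fin k → D.Digit) (τ : ℕ → D.Digit) (i : ℕ) : D.Digit :=
  if h : i < k then w ⟨i, h⟩ else τ (i - k)

theorem append_of_lt {k : ℕ} (w : Fin k → D.Digit) (τ : ℕ → D.Digit) {i : ℕ} (h : i < k) :
    D.append w τ i = w ⟨i, h⟩ := dif_pos h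

theorem append_add {k : ℕ} (w : Fin k → D.Digit) (τ : ℕ → D.Digit) (i : ℕ) :
    D.append w τ (k + i) = τ i := by
  simp [append]

theorem take_append {k : ℕ} (w : Fin k → D.Digit) (τ : ℕ → D.Digit) :
    D.take k (D.append w τ) = w := by
  funext i
  exact D.append_of_lt w τ i.2

theorem append_take (k : ℕ) (ω : ℕ → D.Digit) :
    D.append (D.take k ω) (fun i => ω (k + i)) = ω := by
  funext i
  by_cases h : i < k
  · exact D.append_of_lt _ _ h
  · obtain ⟨j, rfl⟩ := Nat.exists_eq_add_of_le (not_lt.1 h)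
    exact D.append_add _ _ j

/-- This splits a column index into a part depending on `w` alone and a part depending on `τ` alone.
The arbitrary digits that pad `w` lie beyond position `k` and do not enter. -/
theorem prefixValue_col_append {k : ℕ} (w : Fin k → D.Digit) (τ : ℕ → D.Digit) (j : ℕ) :
    prefixValue n (D.colDigit (D.append w τ)) (k + j) =
      prefixValue n (D.colDigit (D.append w fun _ => Classical.arbitrary _)) k * n ^ j +
        prefixValue n (D.colDigit τ) j := by
  rw [prefixValue_add]
  congr 1
  · congr 1
    refine prefixValue_congr fun i hi => ?_
    simp only [colDigit, D.append_of_lt _ _ hi]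
  · refine prefixValue_congr fun i _ => ?_
    simp only [colDigit, append_add]

theorem prefixValue_row_append {k : ℕ} (w : Fin k → D.Digit) (τ : ℕ → D.Digit) (j : ℕ) :
    prefixValue m (D.rowDigit (D.append w τ)) (k + j) =
      prefixValue m (D.rowDigit (D.append w fun _ => Classical.arbitrary _)) k * m ^ j +
        prefixValue m (D.rowDigit τ) j := by
  rw [prefixValue_add]
  congr 1
  · congr 1
    refine prefixValue_congr fun i hi => ?_
    simp only [rowDigit, D.append_of_lt _ _ hi]
  · refine prefixValue_congr fun i _ => ?_
    simp only [rowDigit, append_add]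

theorem finite_image_boxIndex (l K : ℕ) (A : Set (ℕ → D.Digit)) :
    (D.boxIndex l K '' A).Finite := by
  refine ((Set.finite_Iio (n ^ l)).prod (Set.finite_Iio (m ^ K))).subset ?_
  rintro _ ⟨ω, -, rfl⟩
  exact ⟨prefixValue_lt (D.colDigit_lt ω) l, prefixValue_lt (D.rowDigit_lt ω) K⟩

/-- Boxes of rank at least `k` are equidistributed among the cylinders of rank `k`. -/
theorem ncard_image_boxIndex (k p q : ℕ) (T : Set (Fin k → D.Digit)) :
    (D.boxIndex (k + p) (k + q) '' (D.take k ⁻¹' T)).ncard =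
      T.ncard * (Set.range (D.boxIndex p q)).ncard := by
  set u : (Fin k → D.Digit) → ℕ := fun w =>
    prefixValue n (D.colDigit (D.append w fun _ => Classical.arbitrary _)) k with hu
  set v : (Fin k → D.Digit) → ℕ := fun w =>
    prefixValue m (D.rowDigit (D.append w fun _ => Classical.arbitrary _)) k with hv
  set φ : (Fin k → D.Digit) × (ℕ × ℕ) → ℕ × ℕ := fun z =>
    (u z.1 * n ^ p + z.2.1, v z.1 * m ^ q + z.2.2) with hφ
  have hbox : ∀ w τ, D.boxIndex (k + p) (k + q) (D.append w τ) = φ (w, D.boxIndex p q τ) := by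
    intro w τ
    simp only [boxIndex, prefixValue_col_append, prefixValue_row_append, hφ, hu, hv]
  have himage : D.boxIndex (k + p) (k + q) '' (D.take k ⁻¹' T) =
      φ '' (T ×ˢ Set.range (D.boxIndex p q)) := by
    ext z
    constructor
    · rintro ⟨ω, hω, rfl⟩
      refine ⟨(D.take k ω, _), ⟨hω, ⟨fun i => ω (k + i), rfl⟩⟩, ?_⟩
      exact (hbox _ _).symm.trans (by rw [D.append_take])
    · rintro ⟨⟨w, _⟩, ⟨hw, τ, rfl⟩, rfl⟩
      refine ⟨D.append w τ, ?_, hbox w τ⟩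
      rw [Set.mem_preimage, D.take_append]
      exact hw
  rw [himage, Set.InjOn.ncard_image, Set.ncard_prod]
  -- Both box ranks are at least `k`, so the quotients by `n ^ p` and `m ^ q` recover all column and
  -- row digits of `w`, and the remainders recover the box of `τ`.
  rintro ⟨w, _⟩ ⟨-, τ, rfl⟩ ⟨w', _⟩ ⟨-, τ', rfl⟩ h
  simp only [hφ, boxIndex, Prod.mk.injEq] at h
  obtain ⟨h1, h2⟩ := eq_of_mul_add_eq (prefixValue_lt (D.colDigit_lt τ) p)
    (prefixValue_lt (D.colDigit_lt τ') p) h.1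
  obtain ⟨h3, h4⟩ := eq_of_mul_add_eq (prefixValue_lt (D.rowDigit_lt τ) q)
    (prefixValue_lt (D.rowDigit_lt τ') q) h.2
  have hw : w = w' := by
    funext i
    have hc := eq_of_prefixValue_eq (D.colDigit_lt _) (D.colDigit_lt _) h1 i i.2
    have hr := eq_of_prefixValue_eq (D.rowDigit_lt _) (D.rowDigit_lt _) h3 i i.2
    simp only [colDigit, rowDigit, D.append_of_lt _ _ i.2] at hc hr
    exact Subtype.ext (Prod.ext (Fin.ext hc) (Fin.ext hr))
  simp only [boxIndex, hw, h2, h4]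

/-- The measure of a union of cylinders. -/
theorem infinitePi_take_preimage (k : ℕ) (T : Set (Fin k → D.Digit)) :
    (Measure.infinitePi fun _ : ℕ => ProbabilityTheory.uniformOn (Set.univ : Set D.Digit))
      (D.take k ⁻¹' T) = T.ncard * ((Fintype.card D.Digit : ℝ≥0∞)⁻¹) ^ k := by
  classical
  have hmeas : ∀ A : Set D.Digit, MeasurableSet A := fun A => A.toFinite.measurableSet
  have htake : Measurable (D.take k) := measurable_pi_lambda _ fun i => measurable_pi_apply _
  have hcyl : ∀ w : Fin k → D.Digit,
      (Measure.infinitePi fun _ : ℕ => ProbabilityTheory.uniformOn (Set.univ : Set D.Digit))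
        (D.take k ⁻¹' {w}) = ((Fintype.card D.Digit : ℝ≥0∞)⁻¹) ^ k := by
    intro w
    -- The padding of `w` only makes the constraint a function on all of `ℕ`; indices from `k` on
    -- are not constrained.
    have : D.take k ⁻¹' {w} = Set.pi (Finset.range k : Set ℕ)
        fun i => {D.append w (fun _ => Classical.arbitrary _) i} := by
      ext ω
      simp only [Set.mem_preimage, Set.mem_singleton_iff, Set.mem_pi, Finset.mem_coe,
        Finset.mem_range]
      constructor
      · rintro rfl i hi
        rw [D.append_of_lt _ _ hi, take]
      · intro h
        funext i
        rw [take, h i i.2, D.append_of_lt _ _ i.2]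
    rw [this, Measure.infinitePi_pi _ fun i _ => hmeas _]
    simp [ProbabilityTheory.uniformOn_univ]
  have hT : T = ⋃ w ∈ T.toFinset, {w} := by simp
  conv_lhs => rw [hT, Set.preimage_iUnion₂]
  rw [measure_biUnion_finset]
  · simp only [hcyl, Finset.sum_const, nsmul_eq_mul, Set.ncard_eq_toFinset_card']
  · intro w _ w' _ h
    exact Disjoint.preimage _ (Set.disjoint_singleton.2 h)
  · intro w _
    exact htake (measurableSet_singleton w)

/-! ### Boxes and cylinders compared with Euclidean distance -/

theorem dist_le_of_coord {z w : Plane} {a b : ℝ} (h0 : |z 0 - w 0| ≤ a) (h1 : |z 1 - w 1| ≤ b) :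
    dist z w ≤ a + b := by
  have ha := (abs_nonneg _).trans h0
  have hb := (abs_nonneg _).trans h1
  rw [EuclideanSpace.dist_eq, Real.sqrt_le_left (by positivity), Fin.sum_univ_two, Real.dist_eq,
    Real.dist_eq]
  nlinarith [abs_nonneg (z 0 - w 0), abs_nonneg (z 1 - w 1)]

theorem abs_coord_le_dist (z w : Plane) (i : Fin 2) : |z i - w i| ≤ dist z w := by
  rw [dist_eq_norm]
  exact PiLp.norm_apply_le (z - w) i

variable {D}

theorem dist_code_le (hn : 2 ≤ n) (hm : 2 ≤ m) {l K : ℕ} {ω ω' : ℕ → D.Digit}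
    (h : D.boxIndex l K ω = D.boxIndex l K ω') :
    dist (D.code ω) (D.code ω') ≤ 2 / (n : ℝ) ^ l + 2 / (m : ℝ) ^ K := by
  have key : ∀ {b : ℕ} (_ : 2 ≤ b) (a a' : ℕ → Fin b) (k : ℕ),
      prefixValue b (fun i => a i) k = prefixValue b (fun i => a' i) k →
      |∑' i, ((a i : ℕ) : ℝ) / (b : ℝ) ^ (i + 1) - ∑' i, ((a' i : ℕ) : ℝ) / (b : ℝ) ^ (i + 1)| ≤
        2 / (b : ℝ) ^ k := by
    intro b hb a a' k hk
    have h1 := abs_pow_mul_tsum_sub_prefixValue_le hb a k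
    have h2 := abs_pow_mul_tsum_sub_prefixValue_le hb a' k
    rw [hk] at h1
    have hb0 : (0 : ℝ) < (b : ℝ) ^ k := by positivity
    rw [abs_sub_le_iff]
    constructor <;> rw [le_div_iff₀ hb0] <;> linarith [h1.1, h1.2, h2.1, h2.2]
  exact dist_le_of_coord (key hn _ _ l (congrArg Prod.fst h)) (key hm _ _ K (congrArg Prod.snd h))

/-- Rescaling by `n ^ l` or `m ^ K` turns a coordinate into its prefix value up to an error in `[0,
2]`, which accounts for the summand `2` in the hypotheses. The one-sided bound suffices because the
hypotheses are symmetric in `ω` and `ω'`. -/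
theorem boxIndex_le (hn : 2 ≤ n) (hm : 2 ≤ m) {l K M : ℕ} {ω ω' : ℕ → D.Digit}
    (hl : (n : ℝ) ^ l * dist (D.code ω) (D.code ω') + 2 ≤ M)
    (hK : (m : ℝ) ^ K * dist (D.code ω) (D.code ω') + 2 ≤ M) :
    D.boxIndex l K ω ≤ D.boxIndex l K ω' + (M, M) := by
  have key : ∀ {b : ℕ} (_ : 2 ≤ b) (a a' : ℕ → Fin b) (k : ℕ) (d : ℝ),
      |∑' i, ((a i : ℕ) : ℝ) / (b : ℝ) ^ (i + 1) - ∑' i, ((a' i : ℕ) : ℝ) / (b : ℝ) ^ (i + 1)| ≤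
        d → (b : ℝ) ^ k * d + 2 ≤ M →
      prefixValue b (fun i => a i) k ≤ prefixValue b (fun i => a' i) k + M := by
    intro b hb a a' k d hd hk
    have h1 := abs_pow_mul_tsum_sub_prefixValue_le hb a k
    have h2 := abs_pow_mul_tsum_sub_prefixValue_le hb a' k
    have h3 := mul_le_mul_of_nonneg_left ((le_abs_self _).trans hd)
      (show (0 : ℝ) ≤ (b : ℝ) ^ k by positivity)
    rw [← Nat.cast_le (α := ℝ)]
    push_cast
    linarith [h1.1, h1.2, h2.1, h2.2]
  exact ⟨key hn _ _ l _ (abs_coord_le_dist (D.code ω) (D.code ω') 0) hl,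
    key hm _ _ K _ (abs_coord_le_dist (D.code ω) (D.code ω') 1) hK⟩

theorem dist_code_le_of_take_eq (hn : 2 ≤ n) (hm : 2 ≤ m) {k : ℕ} {ω ω' : ℕ → D.Digit}
    (h : D.take k ω = D.take k ω') : dist (D.code ω) (D.code ω') ≤ 4 * (1 / 2 : ℝ) ^ k := by
  have hi : ∀ i < k, ω i = ω' i := fun i hi => congrFun h ⟨i, hi⟩
  have hbox : D.boxIndex k k ω = D.boxIndex k k ω' := Prod.ext
    (prefixValue_congr fun i hk => by simp only [colDigit, hi i hk])
    (prefixValue_congr fun i hk => by simp only [rowDigit, hi i hk])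
  refine (dist_code_le hn hm hbox).trans ?_
  have hpow : ∀ {b : ℕ}, 2 ≤ b → 2 / (b : ℝ) ^ k ≤ 2 * (1 / 2 : ℝ) ^ k := by
    intro b hb
    have hb' : (2 : ℝ) ≤ b := by exact_mod_cast hb
    rw [one_div, inv_pow, div_eq_mul_inv]
    gcongr
  linarith [hpow hn, hpow hm]

end DigitSet
end

/-! ### Box counts and measures under Lipschitz maps -/

noncomputable section

/-- If `c` takes boundedly many values on each fibre of `d` along a correspondence, then its image
is comparatively small. -/
theorem Set.ncard_image_le_mul_ncard_image {X Y : Type*} [Nonempty X] {c : X → ℕ × ℕ} {d : Y → ℕ × ℕ}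
    {B : Set X} {A : Set Y} {M : ℕ} (hc : (c '' B).Finite) (hd : (d '' A).Finite) (g : X → Y)
    (hg : ∀ x ∈ B, g x ∈ A)
    (h : ∀ x ∈ B, ∀ x' ∈ B, d (g x) = d (g x') → c x ≤ c x' + (M, M)) :
    (c '' B).ncard ≤ (2 * M + 1) ^ 2 * (d '' A).ncard := by
  classical
  have hch : ∀ q : ℕ × ℕ, ∃ x, q ∈ c '' B → x ∈ B ∧ c x = q := by
    intro q
    by_cases hq : q ∈ c '' B
    · obtain ⟨x, hx, rfl⟩ := hq
      exact ⟨x, fun _ => ⟨hx, rfl⟩⟩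
    · exact ⟨Classical.arbitrary X, fun h => absurd h hq⟩
  choose s hs using hch
  rw [Set.ncard_eq_toFinset_card _ hc, Set.ncard_eq_toFinset_card _ hd]
  -- Each value of `c` gets one representative through `s`. Two values in the same fibre bound each
  -- other up to `M` in each coordinate, so a fibre lies in a square with at most `2M + 1` integers
  -- per side.
  refine Finset.card_le_mul_card_image_of_maps_to (f := fun q => d (g (s q))) ?_ _ ?_
  · intro q hq
    rw [Set.Finite.mem_toFinset] at hq ⊢
    exact ⟨_, hg _ (hs q hq).1, rfl⟩
  · intro b _
    rcases Finset.eq_empty_or_nonempty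
      (hc.toFinset.filter fun q => d (g (s q)) = b) with he | ⟨q, hq⟩
    · simp [he]
    · have hsub : hc.toFinset.filter (fun q => d (g (s q)) = b) ⊆
          Finset.Icc (q.1 - M) (q.1 + M) ×ˢ Finset.Icc (q.2 - M) (q.2 + M) := by
        intro q' hq'
        rw [Finset.mem_filter, Set.Finite.mem_toFinset] at hq hq'
        have h1 := h _ (hs q hq.1).1 _ (hs q' hq'.1).1 (hq.2.trans hq'.2.symm)
        have h2 := h _ (hs q' hq'.1).1 _ (hs q hq.1).1 (hq'.2.trans hq.2.symm)
        rw [(hs q hq.1).2, (hs q' hq'.1).2] at h1 h2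
        have h11 := h1.1
        have h12 := h1.2
        have h21 := h2.1
        have h22 := h2.2
        simp only [Prod.fst_add, Prod.snd_add] at h11 h12 h21 h22
        simp only [Finset.mem_product, Finset.mem_Icc]
        omega
      refine (Finset.card_le_card hsub).trans ?_
      rw [Finset.card_product, Nat.card_Icc, Nat.card_Icc, sq]
      gcongr <;> omega

namespace DigitSet

variable {n m : ℕ}

/-- A Lipschitz image has at most as many boxes, up to a constant factor. -/
theorem ncard_image_boxIndex_le (hm : 2 ≤ m) (hmn : m < n) (D D' : DigitSet n m)
    {f : D.carpet → D'.carpet} {C : ℝ} (hf : ∀ x y, dist (f x) (f y) ≤ C * dist x y) {M : ℕ}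
    (hM : 4 * n * C + 2 ≤ M) (hC : 0 < C) {l K : ℕ} (hl : n ^ l ≤ m ^ K) (hK : m ^ K < n ^ (l + 1))
    {A : Set (ℕ → D.Digit)} {B : Set (ℕ → D'.Digit)}
    (hAB : ∀ ω ∈ B, ∃ τ ∈ A, f (D.toCarpet τ) = D'.toCarpet ω) :
    (D'.boxIndex l K '' B).ncard ≤ (2 * M + 1) ^ 2 * (D.boxIndex l K '' A).ncard := by
  have hn : 2 ≤ n := by omega
  -- A code in `A` is selected over each code in `B`; off `B` the value is irrelevant.
  have hch : ∀ ω, ∃ τ, ω ∈ B → τ ∈ A ∧ f (D.toCarpet τ) = D'.toCarpet ω := by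
    intro ω
    by_cases hω : ω ∈ B
    · obtain ⟨τ, hτ⟩ := hAB ω hω
      exact ⟨τ, fun _ => hτ⟩
    · exact ⟨Classical.arbitrary _, fun h => absurd h hω⟩
  choose g hg using hch
  refine Set.ncard_image_le_mul_ncard_image (D'.finite_image_boxIndex l K B)
    (D.finite_image_boxIndex l K A) g (fun ω hω => (hg ω hω).1) fun ω hω ω' hω' h => ?_
  have hn0 : (0 : ℝ) < (n : ℝ) ^ l := by positivity
  have hm0 : (0 : ℝ) < (m : ℝ) ^ K := by positivity
  have hl' : (n : ℝ) ^ l ≤ (m : ℝ) ^ K := by exact_mod_cast hl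
  have hK' : (m : ℝ) ^ K ≤ n * (n : ℝ) ^ l := by
    rw [← pow_succ']
    exact_mod_cast hK.le
  have hdist : dist (D'.code ω) (D'.code ω') ≤ C * (2 / (n : ℝ) ^ l + 2 / (m : ℝ) ^ K) := by
    have h1 := hf (D.toCarpet (g ω)) (D.toCarpet (g ω'))
    rw [(hg ω hω).2, (hg ω' hω').2] at h1
    exact h1.trans (mul_le_mul_of_nonneg_left (dist_code_le hn hm h) hC.le)
  -- Since `m ^ K / n ^ l ≤ n`, the rescaled distance is at most `C (2n + 2) ≤ 4nC`, whence the
  -- lower bound required of `M`.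
  have hscale : (m : ℝ) ^ K * dist (D'.code ω) (D'.code ω') + 2 ≤ M := by
    refine le_trans ?_ hM
    have h1 := mul_le_mul_of_nonneg_left hdist hm0.le
    have h2 : (m : ℝ) ^ K * (C * (2 / (n : ℝ) ^ l + 2 / (m : ℝ) ^ K)) =
        C * (2 * ((m : ℝ) ^ K / (n : ℝ) ^ l) + 2) := by
      field_simp
    have h3 : (m : ℝ) ^ K / (n : ℝ) ^ l ≤ n := (div_le_iff₀ hn0).2 hK'
    have h4 : (2 : ℝ) ≤ n := by exact_mod_cast hn
    have h5 : C * (2 * ((m : ℝ) ^ K / (n : ℝ) ^ l) + 2) ≤ C * (4 * n) := by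
      gcongr
      linarith
    linarith
  refine boxIndex_le hn hm (le_trans ?_ hscale) hscale
  gcongr

/-- After division this says that the proportion of words in `T` is at most a constant times the
proportion in `S`. Counting boxes gives `|T| V' ≲ |S| V` through `f` and `N^k V ≲ N'^k V'` through
`g`, where `N`, `N'` are the numbers of digits; multiplying and cancelling eliminates `V` and `V'`.
Each comparison costs `(2M + 1) ^ 2`, hence the fourth power. -/
theorem ncard_cylinders_le (hm : 2 ≤ m) (hmn : m < n) (D D' : DigitSet n m)
    {f : D.carpet → D'.carpet} {g : D'.carpet → D.carpet} {C : ℝ} (hC : 0 < C)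
    (hf : ∀ x y, dist (f x) (f y) ≤ C * dist x y) (hg : ∀ x y, dist (g x) (g y) ≤ C * dist x y)
    (hgs : Function.Surjective g) {M : ℕ} (hM : 4 * n * C + 2 ≤ M) {k : ℕ}
    {S : Set (Fin k → D.Digit)} {T : Set (Fin k → D'.Digit)}
    (hST : ∀ ω, D'.take k ω ∈ T → ∃ τ, D.take k τ ∈ S ∧ f (D.toCarpet τ) = D'.toCarpet ω) :
    T.ncard * Fintype.card D.Digit ^ k ≤
      (2 * M + 1) ^ 4 * (S.ncard * Fintype.card D'.Digit ^ k) := by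
  have hm0 : m ^ (n * k) ≠ 0 := by positivity
  -- Here `K = n * k`, and `l` is chosen to make the boxes approximate squares. This `K` is large
  -- enough to force `l ≥ k`, because `n < 2 ^ n ≤ m ^ n`.
  set l := Nat.log n (m ^ (n * k)) with hl
  have hnl : n ^ l ≤ m ^ (n * k) := Nat.pow_log_le_self n hm0
  have hln : m ^ (n * k) < n ^ (l + 1) := Nat.lt_pow_succ_log_self (by omega) _
  have hkl : k ≤ l := by
    refine (Nat.le_log_iff_pow_le (by omega) hm0).2 ?_
    rw [pow_mul]
    exact Nat.pow_le_pow_left (Nat.lt_two_pow_self.le.trans (Nat.pow_le_pow_left hm n)) k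
  obtain ⟨p, hp⟩ := Nat.exists_eq_add_of_le hkl
  obtain ⟨q, hq⟩ := Nat.exists_eq_add_of_le (show k ≤ n * k from Nat.le_mul_of_pos_left k (by omega))
  have hbox := D.ncard_image_boxIndex k p q
  have hbox' := D'.ncard_image_boxIndex k p q
  rw [← hp, ← hq] at hbox hbox'
  have hcmp := ncard_image_boxIndex_le hm hmn D D' hf hM hC hnl hln
    (A := D.take k ⁻¹' S) (B := D'.take k ⁻¹' T) hST
  have hall := ncard_image_boxIndex_le hm hmn D' D hg hM hC hnl hln
    (A := D'.take k ⁻¹' Set.univ) (B := D.take k ⁻¹' Set.univ) fun ω _ => by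
      obtain ⟨⟨_, τ, rfl⟩, hτ⟩ := hgs (D.toCarpet ω)
      exact ⟨τ, trivial, hτ⟩
  rw [hbox, hbox'] at hcmp hall
  rw [Set.ncard_univ, Set.ncard_univ, Nat.card_eq_fintype_card, Nat.card_eq_fintype_card,
    Fintype.card_fun, Fintype.card_fun, Fintype.card_fin] at hall
  set V := (Set.range (D.boxIndex p q)).ncard
  set V' := (Set.range (D'.boxIndex p q)).ncard
  have hV : 0 < V := by
    have := D.finite_image_boxIndex p q Set.univ
    rw [Set.image_univ] at this
    exact (Set.ncard_pos this).2 (Set.range_nonempty _)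
  refine Nat.le_of_mul_le_mul_right ?_ hV
  calc T.ncard * Fintype.card D.Digit ^ k * V
      = T.ncard * (Fintype.card D.Digit ^ k * V) := by ring
    _ ≤ T.ncard * ((2 * M + 1) ^ 2 * (Fintype.card D'.Digit ^ k * V')) := by gcongr
    _ = (2 * M + 1) ^ 2 * Fintype.card D'.Digit ^ k * (T.ncard * V') := by ring
    _ ≤ (2 * M + 1) ^ 2 * Fintype.card D'.Digit ^ k * ((2 * M + 1) ^ 2 * (S.ncard * V)) := by
      gcongr
    _ = (2 * M + 1) ^ 4 * (S.ncard * Fintype.card D'.Digit ^ k) * V := by ring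

/-- Bi-Lipschitz maps between carpets distort the uniform measure of balls boundedly. -/
theorem uniformMeasure_closedBall_le (hm : 2 ≤ m) (hmn : m < n) (D D' : DigitSet n m)
    {f : D.carpet → D'.carpet} {g : D'.carpet → D.carpet} {C : ℝ} (hC : 0 < C)
    (hf : ∀ x y, dist (f x) (f y) ≤ C * dist x y) (hg : ∀ x y, dist (g x) (g y) ≤ C * dist x y)
    (hfg : Function.LeftInverse f g) (hgf : Function.LeftInverse g f) :
    ∃ a : ℝ≥0, ∀ (x : D.carpet) (r : ℝ), 0 < r →
      D'.uniformMeasure (Metric.closedBall (f x) r) ≤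
        a * D.uniformMeasure (Metric.closedBall x ((2 * C + 1) * r)) := by
  have hn : 2 ≤ n := by omega
  obtain ⟨M, hM⟩ := exists_nat_ge (4 * n * C + 2)
  refine ⟨(2 * M + 1) ^ 4, fun x r hr => ?_⟩
  -- The rank `k` depends on `r` and makes cylinders of diameter at most `r`. The factor already
  -- fixed depends only on `M`.
  obtain ⟨k, hk⟩ := exists_pow_lt_of_lt_one (show 0 < r / 4 by positivity)
    (show (1 / 2 : ℝ) < 1 by norm_num)
  have hcyl : ∀ (G : DigitSet n m) (ω ω' : ℕ → G.Digit), G.take k ω = G.take k ω' →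
      dist (G.toCarpet ω) (G.toCarpet ω') ≤ r := fun G ω ω' h =>
    (dist_code_le_of_take_eq hn hm h).trans (by linarith)
  set T : Set (Fin k → D'.Digit) :=
    D'.take k '' (D'.toCarpet ⁻¹' Metric.closedBall (f x) r) with hT
  set S : Set (Fin k → D.Digit) :=
    D.take k '' (D.toCarpet ⁻¹' Metric.closedBall x (2 * C * r)) with hS
  -- Cylinders meeting the `r`-ball about `f x` lie in the `2r`-ball, which `g` sends into the
  -- `2Cr`-ball about `x`. Enlarging that ball by one more cylinder diameter gives the radius `(2C +
  -- 1) r`.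
  have hST : ∀ ω, D'.take k ω ∈ T → ∃ τ, D.take k τ ∈ S ∧ f (D.toCarpet τ) = D'.toCarpet ω := by
    rintro ω ⟨ω', hω', h⟩
    obtain ⟨τ, hτ⟩ : ∃ τ, D.toCarpet τ = g (D'.toCarpet ω) := by
      obtain ⟨τ, hτ⟩ := (g (D'.toCarpet ω)).2
      exact ⟨τ, Subtype.ext hτ⟩
    refine ⟨τ, ⟨τ, ?_, rfl⟩, by rw [hτ, hfg]⟩
    rw [Set.mem_preimage, Metric.mem_closedBall] at hω' ⊢
    have h1 := hg (D'.toCarpet ω) (f x)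
    rw [hgf, ← hτ] at h1
    have h2 := dist_triangle (D'.toCarpet ω) (D'.toCarpet ω') (f x)
    have h3 := hcyl D' ω ω' h.symm
    nlinarith
  have hcard := ncard_cylinders_le hm hmn D D' hC hf hg hgf.surjective hM hST
  have hle : D'.uniformMeasure (Metric.closedBall (f x) r) ≤
      T.ncard * ((Fintype.card D'.Digit : ℝ≥0∞)⁻¹) ^ k := by
    rw [← infinitePi_take_preimage, uniformMeasure,
      Measure.map_apply (D'.measurable_code hn hm) Metric.isClosed_closedBall.measurableSet]
    exact measure_mono (Set.subset_preimage_image _ _)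
  have hge : S.ncard * ((Fintype.card D.Digit : ℝ≥0∞)⁻¹) ^ k ≤
      D.uniformMeasure (Metric.closedBall x ((2 * C + 1) * r)) := by
    rw [← infinitePi_take_preimage, uniformMeasure,
      Measure.map_apply (D.measurable_code hn hm) Metric.isClosed_closedBall.measurableSet]
    refine measure_mono ?_
    rintro ω ⟨ω', hω', h⟩
    rw [Set.mem_preimage, Metric.mem_closedBall] at hω' ⊢
    have h2 := dist_triangle (D.toCarpet ω) (D.toCarpet ω') x
    have h3 := hcyl D ω ω' h.symm
    linarith
  refine hle.trans (le_trans ?_ (mul_le_mul_right hge _))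
  have hN : (Fintype.card D.Digit : ℝ≥0∞) ^ k ≠ 0 :=
    pow_ne_zero _ (Nat.cast_ne_zero.2 Fintype.card_ne_zero)
  have hN' : (Fintype.card D'.Digit : ℝ≥0∞) ^ k ≠ 0 :=
    pow_ne_zero _ (Nat.cast_ne_zero.2 Fintype.card_ne_zero)
  have hNt : (Fintype.card D.Digit : ℝ≥0∞) ^ k ≠ ∞ := ENNReal.pow_ne_top (ENNReal.natCast_ne_top _)
  have hNt' : (Fintype.card D'.Digit : ℝ≥0∞) ^ k ≠ ∞ :=
    ENNReal.pow_ne_top (ENNReal.natCast_ne_top _)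
  rw [ENNReal.inv_pow.symm, ENNReal.inv_pow.symm, ← div_eq_mul_inv, ← div_eq_mul_inv,
    ← mul_div_assoc, ENNReal.div_le_iff hN' hNt', ← ENNReal.mul_div_right_comm,
    ENNReal.le_div_iff_mul_le (Or.inl hN) (Or.inl hNt), mul_assoc]
  exact_mod_cast hcard

theorem uniformMeasure_closedBall_pos (hn : 2 ≤ n) (hm : 2 ≤ m) (D : DigitSet n m) (x : D.carpet)
    {r : ℝ} (hr : 0 < r) : 0 < D.uniformMeasure (Metric.closedBall x r) := by
  obtain ⟨_, ω, rfl⟩ := x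
  obtain ⟨k, hk⟩ := exists_pow_lt_of_lt_one (show 0 < r / 4 by positivity)
    (show (1 / 2 : ℝ) < 1 by norm_num)
  have hpos : 0 < (Measure.infinitePi fun _ : ℕ =>
      ProbabilityTheory.uniformOn (Set.univ : Set D.Digit)) (D.take k ⁻¹' {D.take k ω}) := by
    rw [infinitePi_take_preimage, Set.ncard_singleton, Nat.cast_one, one_mul]
    exact ENNReal.pow_pos (by simp) k
  rw [uniformMeasure,
    Measure.map_apply (D.measurable_code hn hm) Metric.isClosed_closedBall.measurableSet]
  refine hpos.trans_le (measure_mono fun τ hτ => ?_)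
  exact (dist_code_le_of_take_eq hn hm hτ).trans (by linarith)

end DigitSet
end

/-! ### Local dimension and doubling for comparable measures -/

noncomputable section

section Comparison

/-- Since `log r → -∞`, the constant `b` is negligible and `log (c r) / log r → 1`. -/
theorem tendsto_log_mul_div_log {φ : ℝ → ℝ} {α c : ℝ} (hc : 0 < c) (b : ℝ)
    (h : Tendsto (fun r => Real.log (φ r) / Real.log r) (𝓝[>] 0) (𝓝 α)) :
    Tendsto (fun r => (b + Real.log (φ (c * r))) / Real.log r) (𝓝[>] 0) (𝓝 α) := by
  have hlog : Tendsto (fun r : ℝ => (Real.log r)⁻¹) (𝓝[>] 0) (𝓝 0) :=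
    Real.tendsto_log_nhdsGT_zero.inv_tendsto_atBot
  have hscale : Tendsto (fun r : ℝ => c * r) (𝓝[>] 0) (𝓝[>] 0) := by
    refine tendsto_nhdsWithin_iff.2 ⟨?_, ?_⟩
    · have : Tendsto (fun r : ℝ => c * r) (𝓝 0) (𝓝 (c * 0)) := tendsto_id.const_mul c
      rw [mul_zero] at this
      exact this.mono_left nhdsWithin_le_nhds
    · filter_upwards [self_mem_nhdsWithin] with r hr
      exact mul_pos hc hr
  have hratio : Tendsto (fun r : ℝ => 1 + Real.log c * (Real.log r)⁻¹) (𝓝[>] 0) (𝓝 1) := by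
    simpa using tendsto_const_nhds.add (hlog.const_mul (Real.log c))
  have hlim := (hlog.const_mul b).add ((h.comp hscale).mul hratio)
  rw [mul_zero, zero_add, mul_one] at hlim
  refine hlim.congr' ?_
  have hsmall : ∀ᶠ r : ℝ in 𝓝[>] 0, r < 1 := nhdsWithin_le_nhds (gt_mem_nhds one_pos)
  filter_upwards [self_mem_nhdsWithin, hsmall, hscale.eventually self_mem_nhdsWithin,
    hscale.eventually hsmall] with r hr hr1 hcr hcr1
  have h1 : Real.log r ≠ 0 := (Real.log_neg hr hr1).ne
  have h2 : Real.log (c * r) ≠ 0 := (Real.log_neg hcr hcr1).ne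
  have h3 : 1 + Real.log c * (Real.log r)⁻¹ = Real.log (c * r) / Real.log r := by
    rw [Real.log_mul hc.ne' (ne_of_gt hr)]
    field_simp
    ring
  simp only [Function.comp, h3]
  field_simp

variable {X Y : Type*} [MetricSpace X] [MeasurableSpace X]
  [MetricSpace Y] [MeasurableSpace Y]
  {μ : Measure X} {ν : Measure Y} {f : X → Y} {a : ℝ≥0} {c : ℝ}

/-- Balls of positive finite mass have a finite logarithm, so the extended real limits reduce to a
real one. -/
theorem mem_levelSet_iff [IsFiniteMeasure μ] {x : X}
    (hμ : ∀ r, 0 < r → 0 < μ (Metric.closedBall x r)) {α : ℝ} :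
    x ∈ levelSet μ α ↔ Tendsto (fun r => Real.log (μ.real (Metric.closedBall x r)) / Real.log r)
      (𝓝[>] 0) (𝓝 α) := by
  have hlog : (fun r => logRatio μ x r) =ᶠ[𝓝[>] 0] fun r =>
      ((Real.log (μ.real (Metric.closedBall x r)) / Real.log r : ℝ) : EReal) := by
    filter_upwards [self_mem_nhdsWithin] with r hr
    rw [logRatio, EReal.coe_div, measureReal_def,
      ENNReal.log_pos_real (hμ r hr).ne' (measure_ne_top _ _)]
  rw [← EReal.tendsto_coe, ← tendsto_congr' hlog]
  constructor
  · rintro ⟨h1, h2⟩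
    exact tendsto_of_liminf_eq_limsup h2 h1
  · intro h
    exact ⟨h.limsup_eq, h.liminf_eq⟩

theorem mem_levelSet_of_comparable [IsFiniteMeasure μ] [IsFiniteMeasure ν] (hc : 0 < c) {x : X}
    (hμ : ∀ r, 0 < r → 0 < μ (Metric.closedBall x r))
    (hν : ∀ r, 0 < r → 0 < ν (Metric.closedBall (f x) r))
    (hνμ : ∀ r, 0 < r → ν (Metric.closedBall (f x) r) ≤ a * μ (Metric.closedBall x (c * r)))
    (hμν : ∀ r, 0 < r → μ (Metric.closedBall x r) ≤ a * ν (Metric.closedBall (f x) (c * r)))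
    {α : ℝ} (hx : x ∈ levelSet μ α) : f x ∈ levelSet ν α := by
  rw [mem_levelSet_iff hμ] at hx
  rw [mem_levelSet_iff hν]
  have ha : 0 < (a : ℝ) := by
    rw [NNReal.coe_pos, pos_iff_ne_zero]
    rintro rfl
    simpa using (hν 1 one_pos).trans_le (hνμ 1 one_pos)
  have hμ' : ∀ r, 0 < r → 0 < μ.real (Metric.closedBall x r) := fun r hr =>
    ENNReal.toReal_pos (hμ r hr).ne' (measure_ne_top _ _)
  have hν' : ∀ r, 0 < r → 0 < ν.real (Metric.closedBall (f x) r) := fun r hr =>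
    ENNReal.toReal_pos (hν r hr).ne' (measure_ne_top _ _)
  have hsmall : ∀ᶠ r : ℝ in 𝓝[>] 0, r < 1 := nhdsWithin_le_nhds (gt_mem_nhds one_pos)
  -- Near zero `log r < 0`, so division reverses inequalities: the upper bound for `ν` bounds the
  -- ratio from below. The other side uses `hμν` at radius `c⁻¹ * r`.
  refine tendsto_of_tendsto_of_tendsto_of_le_of_le'
    (tendsto_log_mul_div_log hc (Real.log a) hx)
    (tendsto_log_mul_div_log (inv_pos.2 hc) (-Real.log a) hx) ?_ ?_
  · filter_upwards [self_mem_nhdsWithin, hsmall] with r hr hr1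
    have hr : 0 < r := hr
    refine div_le_div_of_nonpos_of_le (Real.log_neg hr hr1).le ?_
    rw [← Real.log_mul ha.ne' (hμ' _ (by positivity)).ne']
    refine Real.log_le_log (hν' r hr) ?_
    have := ENNReal.toReal_mono (by finiteness) (hνμ r hr)
    simpa [ENNReal.toReal_mul, measureReal_def] using this
  · filter_upwards [self_mem_nhdsWithin, hsmall] with r hr hr1
    have hr : 0 < r := hr
    refine div_le_div_of_nonpos_of_le (Real.log_neg hr hr1).le ?_
    rw [neg_add_le_iff_le_add, ← Real.log_mul ha.ne' (hν' _ hr).ne']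
    refine Real.log_le_log (hμ' _ (by positivity)) ?_
    have := ENNReal.toReal_mono (by finiteness) (hμν (c⁻¹ * r) (by positivity))
    rw [mul_inv_cancel_left₀ hc.ne'] at this
    simpa [ENNReal.toReal_mul, measureReal_def] using this

theorem IsDoublingMeasure.closedBall_le {C : ℝ≥0}
    (h : ∀ (x : X) (r : ℝ), 0 < r →
      μ (Metric.closedBall x (2 * r)) ≤ C * μ (Metric.closedBall x r)) (j : ℕ) (x : X) {r : ℝ}
    (hr : 0 < r) :
    μ (Metric.closedBall x (2 ^ j * r)) ≤ C ^ j * μ (Metric.closedBall x r) := by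
  induction j with
  | zero => simp
  | succ j ih =>
    rw [pow_succ', mul_assoc, pow_succ', mul_assoc]
    exact (h x _ (by positivity)).trans (mul_le_mul_right ih _)

theorem IsDoublingMeasure.of_comparable [IsFiniteMeasure ν] (hc : 0 < c)
    (hf : Function.Surjective f)
    (hν : ∀ y r, 0 < r → 0 < ν (Metric.closedBall y r))
    (hνμ : ∀ x r, 0 < r → ν (Metric.closedBall (f x) r) ≤ a * μ (Metric.closedBall x (c * r)))
    (hμν : ∀ x r, 0 < r → μ (Metric.closedBall x r) ≤ a * ν (Metric.closedBall (f x) (c * r)))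
    (h : IsDoublingMeasure μ) : IsDoublingMeasure ν := by
  obtain ⟨C, -, hC⟩ := h
  -- Passing from `ν` to `μ` and back multiplies a radius by `c` twice, in addition to the doubling
  -- itself; `j` doublings of `μ` cover the total factor `2c²`.
  obtain ⟨j, hj⟩ := pow_unbounded_of_one_lt (c * 2 * c) (one_lt_two (α := ℝ))
  refine ⟨max 1 (a * C ^ j * a), le_max_left _ _, fun y r hr => ⟨hν y _ (by positivity), ?_,
    by finiteness⟩⟩
  obtain ⟨x, rfl⟩ := hf y
  have hcr : 0 < c⁻¹ * r := by positivity
  have hrad : c * (2 * r) ≤ 2 ^ j * (c⁻¹ * r) := by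
    have : c * (2 * r) = c * 2 * c * (c⁻¹ * r) := by field_simp
    rw [this]
    gcongr
  calc ν (Metric.closedBall (f x) (2 * r))
      ≤ a * μ (Metric.closedBall x (c * (2 * r))) := hνμ x _ (by positivity)
    _ ≤ a * μ (Metric.closedBall x (2 ^ j * (c⁻¹ * r))) := by gcongr
    _ ≤ a * (C ^ j * μ (Metric.closedBall x (c⁻¹ * r))) := by
      gcongr
      exact closedBall_le (fun x r hr => (hC x r hr).2.1) j x hcr
    _ ≤ a * (C ^ j * (a * ν (Metric.closedBall (f x) (c * (c⁻¹ * r))))) := by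
      gcongr
      exact hμν x _ hcr
    _ = ((a * C ^ j * a : ℝ≥0) : ℝ≥0∞) * ν (Metric.closedBall (f x) r) := by
      rw [mul_inv_cancel_left₀ hc.ne']
      push_cast
      ring
    _ ≤ ((max 1 (a * C ^ j * a) : ℝ≥0) : ℝ≥0∞) * ν (Metric.closedBall (f x) r) := by
      gcongr
      exact le_max_right _ _

end Comparison
end

/-! ### Transfer along the equivalence -/

theorem LipschitzEquivalent.exists_inverse {X Y : Type*} [MetricSpace X] [MetricSpace Y]
    (h : LipschitzEquivalent X Y) : ∃ (f : X → Y) (g : Y → X) (C : ℝ≥0), 0 < C ∧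
      Function.LeftInverse f g ∧ Function.LeftInverse g f ∧
      (∀ x y, dist (f x) (f y) ≤ C * dist x y) ∧ ∀ x y, dist (g x) (g y) ≤ C * dist x y := by
  obtain ⟨f, hf, C, hC, hfC⟩ := h
  have hinv : ∀ x y, dist x y ≤ C * dist (f x) (f y) := fun x y =>
    (inv_mul_le_iff₀ hC).1 (hfC x y).1
  have hfg := Function.rightInverse_surjInv hf
  refine ⟨f, Function.surjInv hf, ⟨C, hC.le⟩, hC, hfg, ?_, fun x y => (hfC x y).2, fun x y => ?_⟩
  · refine hfg.leftInverse_of_injective fun x y hxy => dist_le_zero.1 ?_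
    simpa [hxy] using hinv x y
  · have := hinv (Function.surjInv hf x) (Function.surjInv hf y)
    rwa [hfg, hfg] at this

theorem corollary1p2 (n m : ℕ) (hm : 2 ≤ m) (hmn : m < n) (D D' : DigitSet n m)
    (hE : IsTotallyDisconnected D.carpet) (hF : IsTotallyDisconnected D'.carpet)
    (hEF : LipschitzEquivalent D.carpet D'.carpet) :
    (∀ α : ℝ, multifractalSpectrum D.uniformMeasure α = multifractalSpectrum D'.uniformMeasure α) ∧
      (IsDoublingMeasure D.uniformMeasure ↔ IsDoublingMeasure D'.uniformMeasure) := by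
  have hn : 2 ≤ n := by omega
  obtain ⟨f, g, C, hC, hfg, hgf, hf, hg⟩ := hEF.exists_inverse
  have hC' : (0 : ℝ) < C := hC
  obtain ⟨a, ha⟩ := DigitSet.uniformMeasure_closedBall_le hm hmn D D' hC' hf hg hfg hgf
  obtain ⟨b, hb⟩ := DigitSet.uniformMeasure_closedBall_le hm hmn D' D hC' hg hf hgf hfg
  have hc : (0 : ℝ) < 2 * C + 1 := by positivity
  have : IsProbabilityMeasure D.uniformMeasure := (D.uniformMeasure_spec hn hm).1
  have : IsProbabilityMeasure D'.uniformMeasure := (D'.uniformMeasure_spec hn hm).1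
  have hpos := fun x r hr => D.uniformMeasure_closedBall_pos hn hm x (r := r) hr
  have hpos' := fun x r hr => D'.uniformMeasure_closedBall_pos hn hm x (r := r) hr
  have h1 : ∀ x r, 0 < r → D'.uniformMeasure (Metric.closedBall (f x) r) ≤
      (max a b : ℝ≥0) * D.uniformMeasure (Metric.closedBall x ((2 * C + 1) * r)) :=
    fun x r hr => (ha x r hr).trans (by gcongr; exact le_max_left a b)
  have h2 : ∀ y r, 0 < r → D.uniformMeasure (Metric.closedBall (g y) r) ≤
      (max a b : ℝ≥0) * D'.uniformMeasure (Metric.closedBall y ((2 * C + 1) * r)) :=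
    fun y r hr => (hb y r hr).trans (by gcongr; exact le_max_right a b)
  have h3 : ∀ x r, 0 < r → D.uniformMeasure (Metric.closedBall x r) ≤
      (max a b : ℝ≥0) * D'.uniformMeasure (Metric.closedBall (f x) ((2 * C + 1) * r)) :=
    fun x r hr => by simpa only [hgf x] using h2 (f x) r hr
  have h4 : ∀ y r, 0 < r → D'.uniformMeasure (Metric.closedBall y r) ≤
      (max a b : ℝ≥0) * D.uniformMeasure (Metric.closedBall (g y) ((2 * C + 1) * r)) :=
    fun y r hr => by simpa only [hfg y] using h1 (g y) r hr
  have hfL : LipschitzWith C f := LipschitzWith.of_dist_le_mul hf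
  have hgL : LipschitzWith C g := LipschitzWith.of_dist_le_mul hg
  refine ⟨fun α => ?_, ?_, ?_⟩
  · have hfα : ∀ x ∈ levelSet D.uniformMeasure α, f x ∈ levelSet D'.uniformMeasure α :=
      fun x => mem_levelSet_of_comparable hc (hpos x) (hpos' (f x)) (h1 x) (h3 x)
    have hgα : ∀ y ∈ levelSet D'.uniformMeasure α, g y ∈ levelSet D.uniformMeasure α :=
      fun y => mem_levelSet_of_comparable hc (hpos' y) (hpos (g y)) (h2 y) (h4 y)
    refine le_antisymm ?_ ?_
    -- Each level set lies in the Lipschitz image of the other, because `f` and `g` are mutually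
    -- inverse.
    · exact (dimH_mono (t := g '' _) fun x hx => ⟨f x, hfα x hx, hgf x⟩).trans (hgL.dimH_image_le _)
    · exact (dimH_mono (t := f '' _) fun y hy => ⟨g y, hgα y hy, hfg y⟩).trans (hfL.dimH_image_le _)
  · exact IsDoublingMeasure.of_comparable hc hfg.surjective hpos' h1 h3
  · exact IsDoublingMeasure.of_comparable hc hgf.surjective hpos h2 h4
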